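/- Let $X$ be a complex Banach space. A spectral measure $P$ on $(\mathbb{C},\mathcal{B}_{\mathbb{C}},X)$ is a map from the Borel sets of $\mathbb{C}$ to the bounded projections on $X$ with $P(\emptyset)=0$, $P(\mathbb{C})=1$, $P(E\cap F)=P(E)P(F)$ for all Borel sets $E,F$, and $P(\bigcup_n E_n)x=\sum_n P(E_n)x$ for all $x\in X$ and all pairwise disjoint Borel sets $E_1,E_2,\dots$. A densely defined closed operator $A:D(A)\subset X\to X$ is a spectral operator with spectral measure $P^A$ if $P^A$ is a spectral measure such that $P^A(E)A\subset AP^A(E)$ and $\sigma(A|_{P^A(E)D(A)})\subset\overline{E}$ for every Borel set $E$, where $A|_{P^A(E)D(A)}$ is regarded as an operator in $P^A(E)X$, and $P^A(E)D(A)=P^A(E)X$ for every bounded Borel set $E$. An operator $B$ in a Banach space $Y$ is of scalar type if $B=\int z\,dP(z)$ for some spectral measure $P$ on $(\mathbb{C},\mathcal{B}_{\mathbb{C}},Y)$, and of finite type if $B=S+N$ with a bounded operator $S$ on $Y$ of scalar type and a nilpotent bounded operator $N$ on $Y$ with $SN=NS$. A bounded projection $P$ on $X$ is weakly associated with $A$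 and $\lambda$ if $PA\subset AP$, $PD(A)=PX$, $A|_{PD(A)}-\lambda$ is nilpotent, and $A|_{(1-P)D(A)}-\lambda$ is injective with dense range in $(1-P)X$. Let $A$ be a spectral operator in $X$ with spectral measure $P^A$ and let $\lambda\in\sigma(A)$. Suppose that for some bounded Borel neighbourhood $\sigma$ of $\lambda$ the operator $A|_{P^A(\sigma)X}$ in $P^A(\sigma)X$ is of finite type. Then $P^A(\{\lambda\})$ is weakly associated with $A$ and $\lambda$, and it is the only bounded projection on $X$ that is weakly associated with $A$ and $\lambda$. -/

import Mathlib

open Filter Topology MeasureTheory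

namespace SpectralOp

variable {X : Type*} [NormedAddCommGroup X] [NormedSpace ℂ X]

/-- The resolvent set of an operator `A : D(A) ⊆ X → X`: all `z` such that `A - z : D(A) → X` is
bijective with bounded inverse `R`. -/
def resolventSet (A : X →ₗ.[ℂ] X) : Set ℂ :=
  {z | ∃ R : X →L[ℂ] X,
    (∀ y : X, ∃ x : A.domain, (x : X) = R y ∧ A x - z • (x : X) = y) ∧
    (∀ x : A.domain, R (A x - z • (x : X)) = x)}

/-- The spectrum `σ(A)` of an operator `A : D(A) ⊆ X → X`. -/
def spectrumSet (A : X →ₗ.[ℂ] X) : Set ℂ := (resolventSet A)ᶜ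

/-- `P A ⊆ A P` for a bounded operator `P`: for `x ∈ D(A)` one has `P x ∈ D(A)` and
`A (P x) = P (A x)`. -/
def CommutesWith (P : X →L[ℂ] X) (A : X →ₗ.[ℂ] X) : Prop :=
  ∀ x : A.domain, ∃ y : A.domain, (y : X) = P x ∧ A y = P (A x)

/-- The range `P X` of a bounded operator, as a subspace of `X`. -/
def ran (P : X →L[ℂ] X) : Submodule ℂ X := LinearMap.range (P : X →ₗ[ℂ] X)

/-- The part of `A` in a subspace `M`, as an operator in `M`: its domain is
`{x ∈ M | x ∈ D(A), A x ∈ M}`. If `P` is a projection with `P A ⊆ A P` and `M = P X`, this domain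
is `P D(A)` (see `mem_part_domain_iff`), so that `part A (ran P)` is the restriction
`A|_{P D(A)}`, regarded as an operator in `P X`. -/
def part (A : X →ₗ.[ℂ] X) (M : Submodule ℂ X) : M →ₗ.[ℂ] M where
  domain :=
    { carrier := {x | ∃ h : (x : X) ∈ A.domain, A ⟨x, h⟩ ∈ M}
      zero_mem' := ⟨A.domain.zero_mem, by
        have : A ⟨((0 : M) : X), A.domain.zero_mem⟩ = 0 := A.map_zero
        rw [this]; exact M.zero_mem⟩
      add_mem' := by
        rintro x y ⟨hx, hx'⟩ ⟨hy, hy'⟩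
        refine ⟨A.domain.add_mem hx hy, ?_⟩
        have : A ⟨((x + y : M) : X), A.domain.add_mem hx hy⟩ = A ⟨x, hx⟩ + A ⟨y, hy⟩ :=
          A.map_add ⟨x, hx⟩ ⟨y, hy⟩
        rw [this]; exact M.add_mem hx' hy'
      smul_mem' := by
        rintro c x ⟨hx, hx'⟩
        refine ⟨A.domain.smul_mem c hx, ?_⟩
        have : A ⟨((c • x : M) : X), A.domain.smul_mem c hx⟩ = c • A ⟨x, hx⟩ :=
          A.map_smul c ⟨x, hx⟩
        rw [this]; exact M.smul_mem c hx' }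
  toFun :=
    { toFun := fun x => ⟨A ⟨(x : M), x.2.1⟩, x.2.2⟩
      map_add' := fun x y => Subtype.ext
        (A.map_add ⟨((x : M) : X), x.2.1⟩ ⟨((y : M) : X), y.2.1⟩)
      map_smul' := fun c x => Subtype.ext (A.map_smul c ⟨((x : M) : X), x.2.1⟩) }

theorem part_apply (A : X →ₗ.[ℂ] X) (M : Submodule ℂ X) (x : (part A M).domain) :
    ((part A M x : M) : X) = A ⟨((x : M) : X), x.2.1⟩ := rfl

theorem mem_part_domain_iff {A : X →ₗ.[ℂ] X} {P : X →L[ℂ] X} (hP : IsIdempotentElem P)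
    (h : CommutesWith P A) (x : ran P) :
    x ∈ (part A (ran P)).domain ↔ ∃ y ∈ A.domain, P y = x := by
  constructor
  · rintro ⟨hx, -⟩
    refine ⟨x, hx, ?_⟩
    obtain ⟨z, hz⟩ := x.2
    have h2 : P (P z) = P z := congrArg (fun T : X →L[ℂ] X => T z) hP
    have h3 : P z = x := hz
    rw [← h3, h2]
  · rintro ⟨y, hy, hyx⟩
    obtain ⟨w, hw, hAw⟩ := h ⟨y, hy⟩
    have hwx : (w : X) = x := hw.trans hyx
    refine ⟨hwx ▸ w.2, ?_⟩
    have : (⟨(x : X), hwx ▸ w.2⟩ : A.domain) = w := Subtype.ext hwx.symm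
    rw [this, hAw]
    exact ⟨_, rfl⟩

/-- A spectral measure on `(ℂ, Borel sets, X)`: a map from the Borel sets of `ℂ` to the bounded
projections on `X` (the values at other sets are irrelevant). -/
structure IsSpectralMeasure (P : Set ℂ → X →L[ℂ] X) : Prop where
  isIdempotentElem : ∀ E, MeasurableSet E → IsIdempotentElem (P E)
  empty : P ∅ = 0
  univ : P Set.univ = 1
  inter : ∀ E F, MeasurableSet E → MeasurableSet F → P (E ∩ F) = P E * P F
  iUnion : ∀ E : ℕ → Set ℂ, (∀ n, MeasurableSet (E n)) → Pairwise (Function.onFun Disjoint E) →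
    ∀ x : X, HasSum (fun n => P (E n) x) (P (⋃ n, E n) x)

/-- `P` is a spectral measure (resolution of the identity) for the operator `A`. -/
structure IsSpectralMeasureFor (P : Set ℂ → X →L[ℂ] X) (A : X →ₗ.[ℂ] X) : Prop where
  isSpectralMeasure : IsSpectralMeasure P
  commutesWith : ∀ E, MeasurableSet E → CommutesWith (P E) A
  spectrum_subset : ∀ E, MeasurableSet E → spectrumSet (part A (ran (P E))) ⊆ closure E
  map_domain : ∀ E, MeasurableSet E → Bornology.IsBounded E →
    A.domain.map (P E : X →ₗ[ℂ] X) = ran (P E)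

/-- A spectral operator: a densely defined closed operator possessing a spectral measure. -/
structure IsSpectralOperator (A : X →ₗ.[ℂ] X) : Prop where
  dense_domain : Dense (A.domain : Set X)
  isClosed : A.IsClosed
  exists_spectralMeasure : ∃ P : Set ℂ → X →L[ℂ] X, IsSpectralMeasureFor P A

/-- `∫ s dP` for a simple function `s`. -/
noncomputable def simpleIntegral (P : Set ℂ → X →L[ℂ] X) (s : SimpleFunc ℂ ℂ) : X →L[ℂ] X :=
  ∑ c ∈ s.range, c • P (s ⁻¹' {c})

/-- `T = ∫ f dP` for a bounded Borel function `f`: `T` is the norm limit of the integrals of a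
sequence of simple functions converging uniformly to `f`. -/
def IsBoundedIntegral (P : Set ℂ → X →L[ℂ] X) (f : ℂ → ℂ) (T : X →L[ℂ] X) : Prop :=
  ∃ s : ℕ → SimpleFunc ℂ ℂ, TendstoUniformly (fun n z => s n z) f atTop ∧
    Tendsto (fun n => simpleIntegral P (s n)) atTop (𝓝 T)

/-- `A = ∫ f dP` for a Borel function `f`, not necessarily bounded: with
`T n = ∫_{|f| ≤ n} f dP`, the domain of `A` consists of all `x` for which `lim T n x` exists, and
`A x = lim T n x` for such `x`. -/
def IsSpectralIntegral (P : Set ℂ → X →L[ℂ] X) (f : ℂ → ℂ) (A : X →ₗ.[ℂ] X) : Prop :=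
  ∃ T : ℕ → X →L[ℂ] X,
    (∀ n : ℕ, IsBoundedIntegral P (Set.indicator {z | ‖f z‖ ≤ n} f) (T n)) ∧
    ∀ x y : X, (x, y) ∈ A.graph ↔ Tendsto (fun n => T n x) atTop (𝓝 y)

/-- A bounded operator on `X`, regarded as an operator with domain `X`. -/
def ofBounded (T : X →L[ℂ] X) : X →ₗ.[ℂ] X := (T : X →ₗ[ℂ] X).toPMap ⊤

/-- Spectral operators of scalar type: `A = ∫ z dP(z)` for some spectral measure `P`. -/
def IsScalarType (A : X →ₗ.[ℂ] X) : Prop :=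
  ∃ P : Set ℂ → X →L[ℂ] X, IsSpectralMeasure P ∧ IsSpectralIntegral P (fun z => z) A

/-- Spectral operators of finite type: `A = S + N` with a bounded `S` of scalar type and a
nilpotent `N` commuting with `S`. -/
def IsFiniteType (A : X →ₗ.[ℂ] X) : Prop :=
  ∃ S N : X →L[ℂ] X, IsScalarType (ofBounded S) ∧ IsNilpotent N ∧ S * N = N * S ∧
    A = ofBounded (S + N)

/-- The bounded projection `P` is weakly associated with `A` and `lam`: `P` commutes with `A`,
`P D(A) = P X`, the operator `A|_{P D(A)} - lam` is nilpotent, and `A|_{(1-P) D(A)} - lam` is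
injective with dense range in `(1 - P) X`. -/
structure IsWeaklyAssociated (P : X →L[ℂ] X) (A : X →ₗ.[ℂ] X) (lam : ℂ) : Prop where
  isIdempotentElem : IsIdempotentElem P
  commutesWith : CommutesWith P A
  map_domain : A.domain.map (P : X →ₗ[ℂ] X) = ran P
  nilpotent : ∃ N : Module.End ℂ (ran P), IsNilpotent N ∧
    part A (ran P) - lam • (LinearMap.id : Module.End ℂ (ran P)).toPMap ⊤ = N.toPMap ⊤
  injective : Function.Injective
    (fun x : (part A (ran (1 - P))).domain => part A (ran (1 - P)) x - lam • (x : ran (1 - P)))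
  denseRange : DenseRange
    (fun x : (part A (ran (1 - P))).domain => part A (ran (1 - P)) x - lam • (x : ran (1 - P)))

end SpectralOp

namespace SpectralOp

variable {X : Type*} [NormedAddCommGroup X] [NormedSpace ℂ X]

/-! The complement of `{lam}` is the union of closed bounded sets `annulus lam n` missing `lam`, so
`A - lam` is bijective on each `P (annulus lam n) X`. By countable additivity an eigenvector in `P
{lam}ᶜ X` vanishes, and the range of `A - lam` there is dense.

On `P {lam} X` the operator `A` is bounded with spectrum in `{lam}`, so `A - lam` is quasinilpotent.
On `P σ X` one has `A = S + N`, where the spectral measure of `S` is not assumed to be related to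
`P`. Since `S - lam` is bounded below on its own spectral subspaces away from `lam`, quasinilpotence
forces the components of `y ∈ P {lam} X` there to vanish. Hence `S y = lam • y`, and `A - lam`
equals the nilpotent `N` on `P {lam} X` (`apply_eq_smul_of_quasinilpotent`).

For uniqueness, nilpotence on `P {lam} X` against injectivity on `(1 - Q) X` gives `Q = 1` on `P
{lam} X`. Surjectivity on `P (annulus lam n) X` against nilpotence on `Q X` gives `Q = 0` there,
hence on `P {lam}ᶜ X`. -/

theorem apply_eq_self_of_mem_ran {P : X →L[ℂ] X} (hP : IsIdempotentElem P) {x : X}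
    (hx : x ∈ ran P) : P x = x := by
  obtain ⟨z, rfl⟩ := hx
  exact congrArg (fun T : X →L[ℂ] X => T z) hP

theorem apply_mem_ran (P : X →L[ℂ] X) (x : X) : P x ∈ ran P := ⟨x, rfl⟩

theorem isClosed_ran {P : X →L[ℂ] X} (hP : IsIdempotentElem P) :
    IsClosed (ran P : Set X) := by
  have : (ran P : Set X) = {x | P x = x} := by
    ext x
    exact ⟨apply_eq_self_of_mem_ran hP, fun h => ⟨x, h⟩⟩
  rw [this]
  exact isClosed_eq P.continuous continuous_id

theorem CommutesWith.one_sub {P : X →L[ℂ] X} {A : X →ₗ.[ℂ] X} (h : CommutesWith P A) :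
    CommutesWith (1 - P) A := by
  intro x
  obtain ⟨y, hy, hAy⟩ := h x
  refine ⟨x - y, by simp [hy], ?_⟩
  rw [A.map_sub, hAy]
  simp

theorem CommutesWith.mem_domain {P : X →L[ℂ] X} {A : X →ₗ.[ℂ] X} (h : CommutesWith P A)
    {x : X} (hx : x ∈ A.domain) : P x ∈ A.domain := by
  obtain ⟨y, hy, -⟩ := h ⟨x, hx⟩
  exact hy ▸ y.2

theorem CommutesWith.apply {P : X →L[ℂ] X} {A : X →ₗ.[ℂ] X} (h : CommutesWith P A)
    {x : X} (hx : x ∈ A.domain) : A ⟨P x, h.mem_domain hx⟩ = P (A ⟨x, hx⟩) := by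
  obtain ⟨y, hy, hAy⟩ := h ⟨x, hx⟩
  rw [← hAy]
  congr 1
  exact Subtype.ext hy.symm

/-! ### Additivity of spectral measures -/

namespace IsSpectralMeasure

variable {P : Set ℂ → X →L[ℂ] X} (hP : IsSpectralMeasure P)
include hP

theorem apply_inter {E F : Set ℂ} (hE : MeasurableSet E) (hF : MeasurableSet F) (x : X) :
    P E (P F x) = P (E ∩ F) x := by
  rw [hP.inter E F hE hF]; rfl

theorem apply_comm {E F : Set ℂ} (hE : MeasurableSet E) (hF : MeasurableSet F) (x : X) :
    P E (P F x) = P F (P E x) := by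
  rw [hP.apply_inter hE hF, hP.apply_inter hF hE, Set.inter_comm]

theorem apply_finset_sum {ι : Type*} (t : Finset ι) {C : ι → Set ℂ}
    (hC : ∀ i ∈ t, MeasurableSet (C i)) (hd : (t : Set ι).PairwiseDisjoint C) (x : X) :
    P (⋃ i ∈ t, C i) x = ∑ i ∈ t, P (C i) x := by
  classical
  -- Packaged as a vector measure, countable additivity yields finite additivity.
  let φ : VectorMeasure ℂ X :=
    { measureOf' := fun E => if MeasurableSet E then P E x else 0
      empty' := by simp [hP.empty]
      not_measurable' := fun E hE => by simp [hE]
      m_iUnion' := fun f hf hd => by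
        simpa [hf, MeasurableSet.iUnion hf] using hP.iUnion f hf hd x }
  have h1 : ∀ E, MeasurableSet E → φ E = P E x := fun E hE => if_pos hE
  rw [← h1 _ (Finset.measurableSet_biUnion _ hC), VectorMeasure.of_biUnion_finset hd hC]
  exact Finset.sum_congr rfl fun i hi => h1 _ (hC i hi)

theorem compl {E : Set ℂ} (hE : MeasurableSet E) : P Eᶜ = 1 - P E := by
  ext x
  have h := hP.apply_finset_sum (Finset.univ : Finset Bool) (C := fun b => cond b E Eᶜ)
    (fun b _ => by cases b <;> simp [hE]) (by
      intro a _ b _ hab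
      cases a <;> cases b <;> simp_all [Function.onFun, disjoint_compl_left, disjoint_compl_right]) x
  have hu : (⋃ b ∈ (Finset.univ : Finset Bool), cond b E Eᶜ) = Set.univ := by
    simp [← Set.union_eq_iUnion]
  rw [hu, hP.univ, Fintype.sum_bool] at h
  exact eq_sub_of_add_eq' h.symm

/-- After disjointification, `P (⋃ n, G n) x` is a limit of finite sums of vectors in the ranges of
the `P (G n)`. This passes from the annuli to `{lam}ᶜ`. -/
theorem ran_iUnion_le {G : ℕ → Set ℂ} (hG : ∀ n, MeasurableSet (G n)) (M : Submodule ℂ X)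
    (hM : IsClosed (M : Set X)) (h : ∀ n, ran (P (G n)) ≤ M) : ran (P (⋃ n, G n)) ≤ M := by
  rintro _ ⟨x, rfl⟩
  have hs := hP.iUnion (disjointed G) (MeasurableSet.disjointed hG) (disjoint_disjointed G) x
  rw [iUnion_disjointed] at hs
  refine hM.mem_of_tendsto hs (Eventually.of_forall fun s => M.sum_mem fun n _ => h n ?_)
  refine ⟨P (disjointed G n) x, ?_⟩
  change P (G n) (P (disjointed G n) x) = _
  rw [hP.apply_inter (hG n) (MeasurableSet.disjointed hG n),
    Set.inter_eq_right.2 (disjointed_subset G n)]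

theorem apply_iUnion_eq_zero {G : ℕ → Set ℂ} (hG : ∀ n, MeasurableSet (G n)) {x : X}
    (h : ∀ n, P (G n) x = 0) : P (⋃ n, G n) x = 0 := by
  have hs := hP.iUnion (disjointed G) (MeasurableSet.disjointed hG) (disjoint_disjointed G) x
  rw [iUnion_disjointed] at hs
  refine hs.unique ?_
  convert! hasSum_zero with n
  rw [← Set.inter_eq_left.2 (disjointed_subset G n),
    ← hP.apply_inter (MeasurableSet.disjointed hG n) (hG n), h, map_zero]

end IsSpectralMeasure

/-- A closed and bounded part of `ℂ`, at distance at least `1 / (n + 1)` from `lam`. -/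
def annulus (lam : ℂ) (n : ℕ) : Set ℂ := {z | 1 / ((n : ℝ) + 1) ≤ ‖z - lam‖ ∧ ‖z‖ ≤ n}

theorem isClosed_annulus (lam : ℂ) (n : ℕ) : IsClosed (annulus lam n) :=
  (isClosed_le (f := fun _ : ℂ => 1 / ((n : ℝ) + 1)) (g := fun z => ‖z - lam‖)
    (by fun_prop) (by fun_prop)).inter
    (isClosed_le (f := fun z : ℂ => ‖z‖) (g := fun _ => (n : ℝ)) (by fun_prop) (by fun_prop))

theorem measurableSet_annulus (lam : ℂ) (n : ℕ) : MeasurableSet (annulus lam n) :=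
  (isClosed_annulus lam n).measurableSet

theorem notMem_annulus (lam : ℂ) (n : ℕ) : lam ∉ annulus lam n := by
  rintro ⟨h, -⟩
  have : 0 < 1 / ((n : ℝ) + 1) := by positivity
  simp only [sub_self, norm_zero] at h
  linarith

theorem iUnion_annulus (lam : ℂ) : ⋃ n, annulus lam n = {lam}ᶜ := by
  ext z
  simp only [Set.mem_iUnion, Set.mem_compl_iff, Set.mem_singleton_iff]
  constructor
  · rintro ⟨n, hn⟩ rfl
    exact notMem_annulus z n hn
  · intro hz
    have h0 : 0 < ‖z - lam‖ := norm_pos_iff.2 (sub_ne_zero.2 hz)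
    obtain ⟨a, ha⟩ := exists_nat_one_div_lt h0
    obtain ⟨b, hb⟩ := exists_nat_ge ‖z‖
    refine ⟨max a b, ?_, hb.trans (by exact_mod_cast le_max_right a b)⟩
    refine le_trans ?_ ha.le
    gcongr
    exact le_max_left a b

/-! ### Injectivity and dense range away from `lam` -/

namespace IsSpectralMeasureFor

variable {P : Set ℂ → X →L[ℂ] X} {A : X →ₗ.[ℂ] X} (hP : IsSpectralMeasureFor P A)
include hP

theorem mem_resolventSet {E : Set ℂ} (hE : MeasurableSet E) {z : ℂ} (hz : z ∉ closure E) :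
    z ∈ resolventSet (part A (ran (P E))) := by
  by_contra h
  exact hz (hP.spectrum_subset E hE h)

/-- `P E x` is annihilated by `A - lam`, which has a left inverse on `P E X` because `lam` is in the
resolvent set there. -/
theorem apply_eq_zero_of_eigenvector {E : Set ℂ} (hE : MeasurableSet E) {lam : ℂ}
    (hlam : lam ∉ closure E) {x : X} (hx : x ∈ A.domain) (hAx : A ⟨x, hx⟩ = lam • x) :
    P E x = 0 := by
  obtain ⟨R, -, hR⟩ := hP.mem_resolventSet hE hlam
  have hc := hP.commutesWith E hE
  have h1 : A ⟨P E x, hc.mem_domain hx⟩ = lam • P E x := by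
    rw [hc.apply hx, hAx, map_smul]
  have h2 : (⟨P E x, apply_mem_ran _ _⟩ : ran (P E)) ∈ (part A (ran (P E))).domain :=
    ⟨hc.mem_domain hx, by rw [h1]; exact Submodule.smul_mem _ _ (apply_mem_ran _ _)⟩
  have h3 := hR ⟨_, h2⟩
  have h4 : part A (ran (P E)) ⟨_, h2⟩ - lam • (⟨P E x, apply_mem_ran _ _⟩ : ran (P E)) = 0 := by
    apply Subtype.ext
    simp [part_apply, h1]
  rw [h4, map_zero] at h3
  exact (congrArg Subtype.val h3).symm

theorem exists_apply_sub_eq {E : Set ℂ} (hE : MeasurableSet E) {lam : ℂ}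
    (hlam : lam ∉ closure E) {y : X} (hy : y ∈ ran (P E)) :
    ∃ x : A.domain, (x : X) ∈ ran (P E) ∧ A x - lam • (x : X) = y := by
  obtain ⟨R, hR, -⟩ := hP.mem_resolventSet hE hlam
  obtain ⟨x, -, hx⟩ := hR ⟨y, hy⟩
  exact ⟨⟨_, x.2.1⟩, x.1.2, congrArg Subtype.val hx⟩

theorem eq_zero_of_eigenvector {lam : ℂ} {x : X} (hx : x ∈ A.domain)
    (hAx : A ⟨x, hx⟩ = lam • x) (hx' : x ∈ ran (P {lam}ᶜ)) : x = 0 := by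
  have hm := hP.isSpectralMeasure
  rw [← apply_eq_self_of_mem_ran
    (hm.isIdempotentElem _ (measurableSet_singleton lam).compl) hx', ← iUnion_annulus]
  exact hm.apply_iUnion_eq_zero (measurableSet_annulus lam) fun n =>
    hP.apply_eq_zero_of_eigenvector (measurableSet_annulus lam n)
      (by rw [(isClosed_annulus lam n).closure_eq]; exact notMem_annulus lam n) hx hAx

theorem injective_compl_singleton (lam : ℂ) : Function.Injective
    (fun x : (part A (ran (P {lam}ᶜ))).domain =>
      part A (ran (P {lam}ᶜ)) x - lam • (x : ran (P {lam}ᶜ))) := by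
  intro x y hxy
  have h : part A (ran (P {lam}ᶜ)) (x - y) = lam • ((x - y : (part A (ran (P {lam}ᶜ))).domain) :
      ran (P {lam}ᶜ)) := by
    rw [LinearPMap.map_sub, Submodule.coe_sub, smul_sub]
    rw [sub_eq_sub_iff_sub_eq_sub]
    exact hxy
  have := hP.eq_zero_of_eigenvector (x - y).2.1 (congrArg Subtype.val h) (x - y).1.2
  exact sub_eq_zero.1 (Subtype.ext (Subtype.ext this))

theorem denseRange_compl_singleton (lam : ℂ) : DenseRange
    (fun x : (part A (ran (P {lam}ᶜ))).domain =>
      part A (ran (P {lam}ᶜ)) x - lam • (x : ran (P {lam}ᶜ))) := by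
  have hm := hP.isSpectralMeasure
  set W := ran (P {lam}ᶜ) with hW
  set f : (part A W).domain →ₗ[ℂ] W := (part A W).toFun - lam • (part A W).domain.subtype
  change DenseRange f
  -- Density is proved for the image in `X`, where the subspaces `P (annulus lam n) X` can be
  -- compared; the subspace topology of `W` returns at the end.
  have hle : ∀ n, ran (P (annulus lam n)) ≤
      ((LinearMap.range f).map W.subtype).topologicalClosure := by
    intro n y hy
    apply Submodule.le_topologicalClosure
    obtain ⟨x, hx, hxy⟩ := hP.exists_apply_sub_eq (measurableSet_annulus lam n)
      (by rw [(isClosed_annulus lam n).closure_eq]; exact notMem_annulus lam n) hy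
    have hsub : ran (P (annulus lam n)) ≤ W := by
      rintro _ ⟨z, rfl⟩
      refine ⟨P (annulus lam n) z, ?_⟩
      change P {lam}ᶜ (P (annulus lam n) z) = _
      rw [hm.apply_inter (measurableSet_singleton lam).compl (measurableSet_annulus lam n),
        Set.inter_eq_right.2 (iUnion_annulus lam ▸ Set.subset_iUnion _ n)]
      rfl
    have hAx : A x ∈ W := by
      have : A x = y + lam • (x : X) := by rw [← hxy]; abel
      rw [this]
      exact W.add_mem (hsub hy) (W.smul_mem _ (hsub hx))
    refine ⟨f ⟨⟨x, hsub hx⟩, x.2, hAx⟩, ⟨_, rfl⟩, ?_⟩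
    rw [← hxy]
    rfl
  have h2 := hm.ran_iUnion_le (measurableSet_annulus lam) _
    (Submodule.isClosed_topologicalClosure _) hle
  rw [iUnion_annulus] at h2
  intro w
  rw [Topology.IsInducing.subtypeVal.closure_eq_preimage_closure_image]
  have h3 := h2 w.2
  rw [← SetLike.mem_coe, Submodule.topologicalClosure_coe, Submodule.map_coe,
    LinearMap.coe_range] at h3
  exact h3

end IsSpectralMeasureFor

/-! ### Uniqueness of the weakly associated projection -/

theorem part_sub_smul_eq_iff {A : X →ₗ.[ℂ] X} {M : Submodule ℂ X} {lam : ℂ}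
    {N : Module.End ℂ M} :
    part A M - lam • (LinearMap.id : Module.End ℂ M).toPMap ⊤ = N.toPMap ⊤ ↔
      ∀ x : M, ∃ h : (x : X) ∈ A.domain, A ⟨x, h⟩ - lam • (x : X) = N x := by
  constructor
  · intro h x
    have hx : x ∈ (part A M - lam • (LinearMap.id : Module.End ℂ M).toPMap ⊤).domain := by
      rw [h]; trivial
    refine ⟨hx.1.1, ?_⟩
    have := @(LinearPMap.ext_iff.1 h).2 x hx trivial
    exact congrArg Subtype.val this
  · intro h
    have hdom : ∀ x : M, x ∈ (part A M).domain := by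
      intro x
      obtain ⟨h1, h2⟩ := h x
      refine ⟨h1, ?_⟩
      rw [sub_eq_iff_eq_add.1 h2]
      exact M.add_mem (N x).2 (M.smul_mem _ x.2)
    refine LinearPMap.ext ?_ ?_
    · ext x
      exact ⟨fun _ => trivial, fun _ => ⟨hdom x, trivial⟩⟩
    · intro x hx hx'
      obtain ⟨h1, h2⟩ := h x
      exact Subtype.ext h2

/-- If `A - lam` is nilpotent on `P X` and injective on `(1 - Q) X`, then `P X ⊆ Q X`. -/
theorem IsWeaklyAssociated.apply_eq_self {Q : X →L[ℂ] X} {A : X →ₗ.[ℂ] X} {lam : ℂ}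
    (hQ : IsWeaklyAssociated Q A lam) {M : Submodule ℂ X} {N : Module.End ℂ M}
    (hN : IsNilpotent N)
    (hAN : part A M - lam • (LinearMap.id : Module.End ℂ M).toPMap ⊤ = N.toPMap ⊤)
    {x : X} (hx : x ∈ M) : Q x = x := by
  obtain ⟨k, hk⟩ := hN
  have key : ∀ k : ℕ, ∀ x : M, (N ^ k) x = 0 → (1 - Q) (x : X) = 0 := by
    intro k
    induction k with
    | zero => intro x hx; simp at hx; simp [hx]
    | succ k ih =>
      intro x hx
      rw [pow_succ] at hx
      have h1 := ih (N x) hx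
      obtain ⟨hd, hA⟩ := part_sub_smul_eq_iff.1 hAN x
      have hc := hQ.commutesWith.one_sub
      -- By induction `1 - Q` kills `N x = (A - lam) x`, so `(1 - Q) x` lies in the kernel of `A -
      -- lam`.
      have h2 : A ⟨(1 - Q) x, hc.mem_domain hd⟩ = lam • (1 - Q) (x : X) := by
        rw [← sub_eq_zero, hc.apply hd, ← map_smul, ← map_sub, hA, h1]
      have h3 : (⟨(1 - Q) x, apply_mem_ran _ _⟩ : ran (1 - Q)) ∈
          (part A (ran (1 - Q))).domain :=
        ⟨hc.mem_domain hd, by rw [h2]; exact Submodule.smul_mem _ _ (apply_mem_ran _ _)⟩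
      have h4 := @hQ.injective ⟨_, h3⟩ 0 (by
        refine Eq.trans (b := (0 : ran (1 - Q))) (Subtype.ext (sub_eq_zero.2 h2)) ?_
        simp)
      exact congrArg (fun u : (part A (ran (1 - Q))).domain => ((u : ran (1 - Q)) : X)) h4
  have := key k ⟨x, hx⟩ (by rw [hk]; rfl)
  exact (sub_eq_zero.1 this).symm

/-- If `A - lam` is nilpotent on `Q X` and maps its domain in `M` onto `M`, then `Q M = 0`. -/
theorem IsWeaklyAssociated.apply_eq_zero {Q : X →L[ℂ] X} {A : X →ₗ.[ℂ] X} {lam : ℂ}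
    (hQ : IsWeaklyAssociated Q A lam) {M : Submodule ℂ X}
    (hM : ∀ y ∈ M, ∃ x : A.domain, (x : X) ∈ M ∧ A x - lam • (x : X) = y)
    {y : X} (hy : y ∈ M) : Q y = 0 := by
  obtain ⟨N, ⟨k, hk⟩, hAN⟩ := hQ.nilpotent
  -- Solving `(A - lam) x = y` repeatedly inside `M` and applying `Q` puts `Q y` in the range of
  -- every power of `N`.
  have key : ∀ k : ℕ, ∀ y ∈ M, ∃ w : ran Q, (N ^ k) w = ⟨Q y, apply_mem_ran _ _⟩ := by
    intro k
    induction k with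
    | zero => exact fun y _ => ⟨_, rfl⟩
    | succ k ih =>
      intro y hy
      obtain ⟨x, hx, hxy⟩ := hM y hy
      obtain ⟨w, hw⟩ := ih x hx
      refine ⟨w, ?_⟩
      rw [pow_succ', Module.End.mul_apply, hw]
      apply Subtype.ext
      obtain ⟨hd, hA⟩ := part_sub_smul_eq_iff.1 hAN ⟨Q x, apply_mem_ran _ _⟩
      rw [← hA, hQ.commutesWith.apply x.2]
      change Q (A x) - lam • Q x = Q y
      rw [← hxy, map_sub, map_smul]
  obtain ⟨w, hw⟩ := key k y hy
  rw [hk] at hw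
  exact (congrArg Subtype.val hw).symm

theorem IsSpectralMeasureFor.eq_of_isWeaklyAssociated {P : Set ℂ → X →L[ℂ] X} {A : X →ₗ.[ℂ] X}
    (hP : IsSpectralMeasureFor P A) {lam : ℂ} (h : IsWeaklyAssociated (P {lam}) A lam)
    {Q : X →L[ℂ] X} (hQ : IsWeaklyAssociated Q A lam) : Q = P {lam} := by
  have hm := hP.isSpectralMeasure
  have h1 : ∀ x, Q (P {lam} x) = P {lam} x := by
    intro x
    obtain ⟨N, hN, hAN⟩ := h.nilpotent
    exact hQ.apply_eq_self hN hAN (apply_mem_ran _ _)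
  have h2 : ∀ x, Q (P {lam}ᶜ x) = 0 := by
    intro x
    have := hm.ran_iUnion_le (measurableSet_annulus lam) (LinearMap.ker (Q : X →ₗ[ℂ] X))
      (isClosed_singleton.preimage Q.continuous) (fun n y hy => by
        refine hQ.apply_eq_zero (M := ran (P (annulus lam n))) (fun y hy => ?_) hy
        exact hP.exists_apply_sub_eq (measurableSet_annulus lam n)
          (by rw [(isClosed_annulus lam n).closure_eq]; exact notMem_annulus lam n) hy)
    rw [iUnion_annulus] at this
    exact this (apply_mem_ran _ _)
  ext x
  have h3 := h2 x
  rw [hm.compl (measurableSet_singleton lam)] at h3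
  have h4 : Q (x - P {lam} x) = 0 := h3
  rw [map_sub, h1, sub_eq_zero] at h4
  exact h4

/-! ### Uniform bounds for simple integrals -/

theorem sum_abs_signedMeasure_le (s : SignedMeasure ℂ) (t : Finset ℂ) {C : ℂ → Set ℂ}
    (hC : ∀ i ∈ t, MeasurableSet (C i)) (hd : (t : Set ℂ).PairwiseDisjoint C) :
    ∑ i ∈ t, |s (C i)| ≤ s.totalVariation.real Set.univ := by
  calc ∑ i ∈ t, |s (C i)| ≤ ∑ i ∈ t, s.totalVariation.real (C i) :=
        Finset.sum_le_sum fun i _ => s.norm_le_totalVariation (C i)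
    _ = s.totalVariation.real (⋃ i ∈ t, C i) := (measureReal_biUnion_finset hd hC).symm
    _ ≤ s.totalVariation.real Set.univ := measureReal_mono (Set.subset_univ _)

theorem exists_sum_norm_complexMeasure_le (c : ComplexMeasure ℂ) :
    ∃ V : ℝ, ∀ (t : Finset ℂ) (C : ℂ → Set ℂ), (∀ i ∈ t, MeasurableSet (C i)) →
      (t : Set ℂ).PairwiseDisjoint C → ∑ i ∈ t, ‖c (C i)‖ ≤ V := by
  refine ⟨(ComplexMeasure.re c).totalVariation.real Set.univ +
    (ComplexMeasure.im c).totalVariation.real Set.univ, fun t C hC hd => ?_⟩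
  refine le_trans (Finset.sum_le_sum fun i _ => Complex.norm_le_abs_re_add_abs_im (c (C i))) ?_
  rw [Finset.sum_add_distrib]
  exact add_le_add (sum_abs_signedMeasure_le (ComplexMeasure.re c) t hC hd)
    (sum_abs_signedMeasure_le (ComplexMeasure.im c) t hC hd)

namespace IsSpectralMeasure

variable {P : Set ℂ → X →L[ℂ] X} (hP : IsSpectralMeasure P)
include hP

/-- `E ↦ φ (P E x)` is a complex measure, hence of finite total variation. -/
theorem exists_sum_norm_dual_le (x : X) (φ : X →L[ℂ] ℂ) :
    ∃ V : ℝ, ∀ (t : Finset ℂ) (C : ℂ → Set ℂ), (∀ i ∈ t, MeasurableSet (C i)) →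
      (t : Set ℂ).PairwiseDisjoint C → ∑ i ∈ t, ‖φ (P (C i) x)‖ ≤ V := by
  classical
  let c : ComplexMeasure ℂ :=
    { measureOf' := fun E => if MeasurableSet E then φ (P E x) else 0
      empty' := by simp [hP.empty]
      not_measurable' := fun E hE => by simp [hE]
      m_iUnion' := fun f hf hd => by
        simpa [hf, MeasurableSet.iUnion hf] using (hP.iUnion f hf hd x).mapL φ }
  obtain ⟨V, hV⟩ := exists_sum_norm_complexMeasure_le c
  refine ⟨V, fun t C hC hd => (Finset.sum_congr rfl fun i hi => ?_).trans_le (hV t C hC hd)⟩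
  have : c (C i) = φ (P (C i) x) := if_pos (hC i hi)
  rw [this]

/-- Simple integrals against a spectral measure are bounded by a multiple of the supremum norm of
the integrand. -/
theorem exists_norm_sum_le [CompleteSpace X] :
    ∃ K : ℝ, ∀ (t : Finset ℂ) (C : ℂ → Set ℂ) (a : ℂ → ℂ), (∀ i ∈ t, MeasurableSet (C i)) →
      (t : Set ℂ).PairwiseDisjoint C → (∀ i, ‖a i‖ ≤ 1) → ‖∑ i ∈ t, a i • P (C i)‖ ≤ K := by
  -- Uniform boundedness is used twice over this index set: in the bidual for fixed `x`, then for
  -- the operators themselves.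
  let ι := {p : Finset ℂ × (ℂ → Set ℂ) × (ℂ → ℂ) // (∀ i ∈ p.1, MeasurableSet (p.2.1 i)) ∧
    (p.1 : Set ℂ).PairwiseDisjoint p.2.1 ∧ ∀ i, ‖p.2.2 i‖ ≤ 1}
  let g : ι → X →L[ℂ] X := fun p => ∑ i ∈ p.1.1, p.1.2.2 i • P (p.1.2.1 i)
  obtain ⟨K, hK⟩ := banach_steinhaus (g := g) (by
    intro x
    obtain ⟨K, hK⟩ := banach_steinhaus
      (g := fun p : ι => NormedSpace.inclusionInDoubleDual ℂ X (g p x)) (by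
        intro φ
        obtain ⟨V, hV⟩ := hP.exists_sum_norm_dual_le x φ
        refine ⟨V, fun p => le_trans ?_ (hV p.1.1 p.1.2.1 p.2.1 p.2.2.1)⟩
        rw [NormedSpace.dual_def]
        simp only [g, sum_apply, smul_apply, map_sum, map_smul]
        refine (norm_sum_le _ _).trans (Finset.sum_le_sum fun i _ => ?_)
        rw [norm_smul]
        exact mul_le_of_le_one_left (norm_nonneg _) (p.2.2.2 i))
    refine ⟨K, fun p => ?_⟩
    rw [← (NormedSpace.inclusionInDoubleDualLi ℂ (E := X)).norm_map]
    exact hK p)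
  exact ⟨K, fun t C a h1 h2 h3 => hK ⟨(t, C, a), h1, h2, h3⟩⟩

theorem sum_fiber_inter {E : Set ℂ} (hE : MeasurableSet E) (s : SimpleFunc ℂ ℂ) (x : X) :
    ∑ c ∈ s.range, P (s ⁻¹' {c} ∩ E) x = P E x := by
  rw [← hP.apply_finset_sum s.range (fun c _ => (s.measurableSet_fiber c).inter hE)]
  · congr 2
    ext z
    simp
  · intro c _ d _ hcd
    refine Set.disjoint_left.2 fun z hz hz' => hcd ?_
    exact hz.1.symm.trans hz'.1

/-- If the values of `s` on `E` have distance at least `r` from `lam`, then `∫ s dP - lam` is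
bounded below on the range of `P E`, with a constant depending on `r` only. -/
theorem norm_le_of_simple {K : ℝ}
    (hK : ∀ (t : Finset ℂ) (C : ℂ → Set ℂ) (a : ℂ → ℂ), (∀ i ∈ t, MeasurableSet (C i)) →
      (t : Set ℂ).PairwiseDisjoint C → (∀ i, ‖a i‖ ≤ 1) → ‖∑ i ∈ t, a i • P (C i)‖ ≤ K)
    {E : Set ℂ} (hE : MeasurableSet E) {s : SimpleFunc ℂ ℂ} {lam : ℂ} {r : ℝ} (hr : 0 < r)
    (hs : ∀ z ∈ E, r ≤ ‖s z - lam‖) (x : X) :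
    r * ‖P E x‖ ≤ K * ‖P E (simpleIntegral P s x - lam • x)‖ := by
  classical
  -- `U` is `r` times an inverse of `∫ s dP - lam` on `P E X`; the factor `r` makes the coefficients
  -- at most 1. The value 0 is harmless, since those fibres miss `E`.
  let a : ℂ → ℂ := fun c => if r ≤ ‖c - lam‖ then r * (c - lam)⁻¹ else 0
  let U : X →L[ℂ] X := ∑ c ∈ s.range, a c • P (s ⁻¹' {c} ∩ E)
  have hd : ((s.range : Finset ℂ) : Set ℂ).PairwiseDisjoint fun c => s ⁻¹' {c} ∩ E := by
    intro c _ d _ hcd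
    refine Set.disjoint_left.2 fun z hz hz' => hcd ?_
    exact hz.1.symm.trans hz'.1
  have hm : ∀ c, MeasurableSet (s ⁻¹' {c} ∩ E) := fun c => (s.measurableSet_fiber c).inter hE
  have hU : ‖U‖ ≤ K := by
    refine hK _ _ _ (fun c _ => hm c) hd fun c => ?_
    by_cases h : r ≤ ‖c - lam‖
    · simp only [a, if_pos h, norm_mul, norm_inv, Complex.norm_real, Real.norm_eq_abs,
        abs_of_pos hr]
      rw [← div_eq_mul_inv]
      exact div_le_one_of_le₀ h (norm_nonneg _)
    · simp [a, if_neg h]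
  have hUS : U (P E (simpleIntegral P s x - lam • x)) = (r : ℂ) • P E x := by
    have h1 : P E (simpleIntegral P s x - lam • x)
        = ∑ c ∈ s.range, (c - lam) • P (s ⁻¹' {c} ∩ E) x := by
      simp only [sub_smul, Finset.sum_sub_distrib, ← Finset.smul_sum]
      rw [hP.sum_fiber_inter hE, map_sub, map_smul]
      simp only [simpleIntegral, sum_apply, smul_apply, map_sum, map_smul]
      congr 1
      exact Finset.sum_congr rfl fun c _ => by
        rw [hP.apply_inter hE (s.measurableSet_fiber c), Set.inter_comm]
    rw [h1, ← hP.sum_fiber_inter hE s, Finset.smul_sum]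
    simp only [U, sum_apply, smul_apply, map_sum, map_smul]
    refine Finset.sum_congr rfl fun c hc => ?_
    rw [Finset.sum_eq_single_of_mem c hc (fun d hd' hdc => by
      rw [hP.apply_inter (hm d) (hm c),
        Set.disjoint_iff_inter_eq_empty.1 (hd hd' hc hdc), hP.empty]
      simp)]
    rw [hP.apply_inter (hm c) (hm c), Set.inter_self, smul_smul]
    by_cases hne : (s ⁻¹' {c} ∩ E).Nonempty
    · obtain ⟨z, hz, hzE⟩ := hne
      have hzc : s z = c := hz
      have h3 := hs z hzE
      rw [hzc] at h3
      have h4 : c - lam ≠ 0 := norm_pos_iff.1 (hr.trans_le h3)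
      simp only [a, if_pos h3]
      congr 1
      field_simp
    · rw [Set.not_nonempty_iff_eq_empty.1 hne, hP.empty]
      simp
  calc r * ‖P E x‖ = ‖U (P E (simpleIntegral P s x - lam • x))‖ := by
        rw [hUS, norm_smul, Complex.norm_real, Real.norm_eq_abs, abs_of_pos hr]
    _ ≤ ‖U‖ * ‖P E (simpleIntegral P s x - lam • x)‖ := U.le_opNorm _
    _ ≤ K * ‖P E (simpleIntegral P s x - lam • x)‖ := by gcongr

theorem simpleIntegral_apply_singleton (lam : ℂ) (s : SimpleFunc ℂ ℂ) (x : X) :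
    simpleIntegral P s (P {lam} x) = s lam • P {lam} x := by
  simp only [simpleIntegral, sum_apply, smul_apply]
  rw [Finset.sum_eq_single_of_mem (s lam) (s.mem_range_self lam)]
  · rw [hP.apply_inter (s.measurableSet_fiber _) (measurableSet_singleton lam),
      Set.inter_eq_right.2 (by simp)]
  · intro c _ hc
    rw [hP.apply_inter (s.measurableSet_fiber _) (measurableSet_singleton lam),
      Set.inter_singleton_eq_empty.2 (by simpa using hc.symm), hP.empty]
    simp

/-- A scalar operator `S = ∫ z dP` satisfies `S = lam` on the range of `P {lam}`. -/
theorem apply_singleton_of_isSpectralIntegral {S : X →L[ℂ] X}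
    (hS : IsSpectralIntegral P (fun z => z) (ofBounded S)) (lam : ℂ) (x : X) :
    S (P {lam} x) = lam • P {lam} x := by
  obtain ⟨T, hT, hgraph⟩ := hS
  have hlim := (hgraph (P {lam} x) (S (P {lam} x))).1
    ((LinearPMap.mem_graph_iff _).2 ⟨⟨_, trivial⟩, rfl, rfl⟩)
  refine tendsto_nhds_unique hlim (tendsto_const_nhds.congr' ?_)
  obtain ⟨m, hm⟩ := exists_nat_ge ‖lam‖
  -- Once `n ≥ ‖lam‖`, the truncated integrand still takes the value `lam` at `lam`.
  filter_upwards [eventually_ge_atTop m] with n hn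
  obtain ⟨s, hs, hsT⟩ := hT n
  have h1 : Tendsto (fun k => simpleIntegral P (s k) (P {lam} x)) atTop (𝓝 (T n (P {lam} x))) :=
    ((ContinuousLinearMap.apply ℂ X (P {lam} x)).continuous.tendsto _).comp hsT
  simp only [hP.simpleIntegral_apply_singleton] at h1
  refine tendsto_nhds_unique ?_ h1
  have h2 := hs.tendsto_at lam
  rw [Set.indicator_of_mem (show lam ∈ {z : ℂ | ‖z‖ ≤ n} from
    hm.trans (by exact_mod_cast hn))] at h2
  exact h2.smul_const _

/-- A scalar operator `S = ∫ z dP` is such that `S - lam` is bounded below on `P E X`, for each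
bounded Borel set `E` at positive distance from `lam`. -/
theorem norm_le_of_isSpectralIntegral {K : ℝ}
    (hK : ∀ (t : Finset ℂ) (C : ℂ → Set ℂ) (a : ℂ → ℂ), (∀ i ∈ t, MeasurableSet (C i)) →
      (t : Set ℂ).PairwiseDisjoint C → (∀ i, ‖a i‖ ≤ 1) → ‖∑ i ∈ t, a i • P (C i)‖ ≤ K)
    {S : X →L[ℂ] X} (hS : IsSpectralIntegral P (fun z => z) (ofBounded S))
    {E : Set ℂ} (hE : MeasurableSet E) {m : ℕ} (hm : ∀ z ∈ E, ‖z‖ ≤ m) {lam : ℂ} {r : ℝ}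
    (hr : 0 < r) (hEr : ∀ z ∈ E, r ≤ ‖z - lam‖) (x : X) :
    r / 2 * ‖P E x‖ ≤ K * ‖P E (S x - lam • x)‖ := by
  obtain ⟨T, hT, hgraph⟩ := hS
  have hlim := (hgraph x (S x)).1 ((LinearPMap.mem_graph_iff _).2 ⟨⟨_, trivial⟩, rfl, rfl⟩)
  have hc : Continuous fun y => K * ‖P E (y - lam • x)‖ := by fun_prop
  refine le_of_tendsto_of_tendsto tendsto_const_nhds ((hc.tendsto _).comp hlim) ?_
  filter_upwards [eventually_ge_atTop m] with n hn
  obtain ⟨s, hs, hsT⟩ := hT n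
  have h1 : Tendsto (fun k => simpleIntegral P (s k) x) atTop (𝓝 (T n x)) :=
    ((ContinuousLinearMap.apply ℂ X x).continuous.tendsto _).comp hsT
  refine le_of_tendsto_of_tendsto tendsto_const_nhds ((hc.tendsto _).comp h1) ?_
  -- Uniform error below `r / 2` keeps the simple functions at distance at least `r / 2` from `lam`
  -- on `E`.
  filter_upwards [Metric.tendstoUniformly_iff.1 hs (r / 2) (half_pos hr)] with k hk
  refine hP.norm_le_of_simple hK hE (half_pos hr) (fun z hz => ?_) x
  have h2 := hk z
  rw [Set.indicator_of_mem (show z ∈ {z : ℂ | ‖z‖ ≤ n} from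
    (hm z hz).trans (by exact_mod_cast hn)), dist_eq_norm] at h2
  have h3 := hEr z hz
  have h4 : ‖z - lam‖ ≤ ‖z - s k z‖ + ‖s k z - lam‖ := norm_sub_le_norm_sub_add_norm_sub _ _ _
  linarith

end IsSpectralMeasure

/-! ### Quasinilpotent vectors -/

/-- If `D` is locally quasinilpotent at `y`, and if `D - N` is bounded below modulo the kernel of
`E`, where `N` is nilpotent and commutes with `D`, then `E y = 0`. -/
theorem apply_eq_zero_of_quasinilpotent {D N E : X →L[ℂ] X} {C : ℝ} (hC : 0 ≤ C)
    (hDN : Commute D N) (hN : IsNilpotent N) (hE : ∀ y, ‖E y‖ ≤ C * ‖E (D y - N y)‖)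
    {y : X} (hy : ∀ c : ℝ, Tendsto (fun n : ℕ => c ^ n * ‖(D ^ n) y‖) atTop (𝓝 0)) : E y = 0 := by
  have hinv : ∀ M : X →L[ℂ] X, Commute D M → ∀ y,
      (∀ c : ℝ, Tendsto (fun n : ℕ => c ^ n * ‖(D ^ n) y‖) atTop (𝓝 0)) →
      ∀ c : ℝ, Tendsto (fun n : ℕ => c ^ n * ‖(D ^ n) (M y)‖) atTop (𝓝 0) := by
    intro M hM y hy c
    have h0 : Tendsto (fun n : ℕ => ‖M‖ * |c ^ n * ‖(D ^ n) y‖|) atTop (𝓝 0) := by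
      simpa using (hy c).abs.const_mul ‖M‖
    refine squeeze_zero_norm (fun n => ?_) h0
    have h1 : (D ^ n) (M y) = M ((D ^ n) y) :=
      congrArg (fun T : X →L[ℂ] X => T y) (hM.pow_left n).eq
    rw [h1, norm_mul, norm_norm, abs_mul, abs_norm, Real.norm_eq_abs]
    calc |c ^ n| * ‖M ((D ^ n) y)‖ ≤ |c ^ n| * (‖M‖ * ‖(D ^ n) y‖) := by
          gcongr; exact M.le_opNorm _
      _ = _ := by ring
  obtain ⟨k, hk⟩ := hN
  have key : ∀ j : ℕ, ∀ y,
      (∀ c : ℝ, Tendsto (fun n : ℕ => c ^ n * ‖(D ^ n) y‖) atTop (𝓝 0)) →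
      (N ^ j) y = 0 → E y = 0 := by
    intro j
    induction j with
    | zero => intro y _ h; simp at h; simp [h]
    | succ j ih =>
      intro y hy hj
      -- `N (D ^ n y)` is again quasinilpotent for `D` and is killed by `N ^ j`. Thus the term `N`
      -- drops out of `hE` along the orbit of `y`, and the bound can be iterated.
      have h1 : ∀ n : ℕ, E (N ((D ^ n) y)) = 0 := by
        intro n
        refine ih _ (hinv N hDN _ (hinv (D ^ n) ((Commute.refl D).pow_right n) y hy)) ?_
        have h2 : (N ^ j) (N ((D ^ n) y)) = (D ^ n) ((N ^ (j + 1)) y) := by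
          have := congrArg (fun T : X →L[ℂ] X => T y) ((hDN.pow_left n).pow_right (j + 1)).eq
          rw [pow_succ] at this ⊢
          exact this.symm
        rw [h2, hj, map_zero]
      have h3 : ∀ n : ℕ, ‖E y‖ ≤ C ^ n * ‖E ((D ^ n) y)‖ := by
        intro n
        induction n with
        | zero => simp
        | succ n ihn =>
          have h4 := hE ((D ^ n) y)
          rw [map_sub, h1 n, sub_zero] at h4
          calc ‖E y‖ ≤ C ^ n * ‖E ((D ^ n) y)‖ := ihn
            _ ≤ C ^ n * (C * ‖E (D ((D ^ n) y))‖) := by gcongr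
            _ = C ^ (n + 1) * ‖E ((D ^ (n + 1)) y)‖ := by
              rw [pow_succ' D, mul_apply_eq_comp]; ring
      have h5 : Tendsto (fun n : ℕ => ‖E‖ * (C ^ n * ‖(D ^ n) y‖)) atTop (𝓝 0) := by
        simpa using (hy C).const_mul ‖E‖
      have h6 : ‖E y‖ ≤ 0 := by
        refine ge_of_tendsto' h5 fun n => (h3 n).trans ?_
        calc C ^ n * ‖E ((D ^ n) y)‖ ≤ C ^ n * (‖E‖ * ‖(D ^ n) y‖) := by
              gcongr; exact E.le_opNorm _
          _ = _ := by ring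
      exact norm_le_zero_iff.1 h6
  exact key k y hy (by rw [hk]; rfl)

/-- A scalar operator `S` plus a commuting nilpotent operator `N` acts as `lam + N` on each vector
at which `S + N - lam` is locally quasinilpotent. -/
theorem apply_eq_smul_of_quasinilpotent [CompleteSpace X] {S N : X →L[ℂ] X} {lam : ℂ}
    (hS : IsScalarType (ofBounded S)) (hN : IsNilpotent N) (hSN : S * N = N * S) {y : X}
    (hy : ∀ c : ℝ, Tendsto (fun n : ℕ => c ^ n * ‖((S + N - lam • 1 : X →L[ℂ] X) ^ n) y‖)
      atTop (𝓝 0)) : S y = lam • y := by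
  obtain ⟨P, hP, hint⟩ := hS
  obtain ⟨K, hK⟩ := hP.exists_norm_sum_le
  have hK0 : 0 ≤ K := by simpa using hK ∅ (fun _ => ∅) 0 (by simp) (by simp) (by simp)
  have hc : Commute (S + N - lam • 1) N :=
    ((show Commute S N from hSN).add_left (Commute.refl N)).sub_left
      ((Commute.one_left N).smul_left lam)
  have h0 : P {lam}ᶜ y = 0 := by
    rw [← iUnion_annulus]
    refine hP.apply_iUnion_eq_zero (measurableSet_annulus lam) fun n => ?_
    have hr : (0 : ℝ) < 1 / ((n : ℝ) + 1) := by positivity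
    -- With `D = S + N - lam`, the difference `D - N` is `S - lam`; `C` is the reciprocal of its
    -- lower bound on the annulus.
    refine apply_eq_zero_of_quasinilpotent (C := K / (1 / ((n : ℝ) + 1) / 2)) (by positivity)
      hc hN (fun x => ?_) hy
    have h1 := hP.norm_le_of_isSpectralIntegral hK hint (measurableSet_annulus lam n)
      (fun z hz => hz.2) hr (fun z hz => hz.1) x
    have h2 : (S + N - lam • 1 : X →L[ℂ] X) x - N x = S x - lam • x := by
      change S x + N x - lam • x - N x = _
      abel
    rw [h2, div_mul_eq_mul_div, le_div_iff₀ (half_pos hr), mul_comm]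
    exact h1
  rw [hP.compl (measurableSet_singleton lam)] at h0
  have h1 : y = P {lam} y := sub_eq_zero.1 h0
  rw [h1]
  exact hP.apply_singleton_of_isSpectralIntegral hint lam y

theorem tendsto_pow_mul_norm_pow_of_spectrum_subset {B : Type*} [NormedRing B]
    [NormedAlgebra ℂ B] [CompleteSpace B] {a : B} (ha : spectrum ℂ a ⊆ {0}) (c : ℝ) :
    Tendsto (fun n : ℕ => c ^ n * ‖a ^ n‖) atTop (𝓝 0) := by
  have hr : spectralRadius ℂ a = 0 := by
    simp only [spectralRadius, ENNReal.iSup_eq_zero]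
    intro k hk
    simp [Set.mem_singleton_iff.1 (ha hk)]
  have h := spectrum.pow_norm_pow_one_div_tendsto_nhds_spectralRadius a
  rw [hr] at h
  -- Chosen so that `|c|` times this number is at most `1 / 2`; the added 1 covers `c = 0`.
  have hε : 0 < 1 / (2 * (|c| + 1)) := by positivity
  have h1 : Tendsto (fun n : ℕ => (1 / 2 : ℝ) ^ n) atTop (𝓝 0) :=
    tendsto_pow_atTop_nhds_zero_of_lt_one (by norm_num) (by norm_num)
  refine squeeze_zero_norm' ?_ h1
  filter_upwards [h.eventually_lt_const (ENNReal.ofReal_pos.2 hε), eventually_gt_atTop 0]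
    with n hn hn0
  have h2 : ‖a ^ n‖ ^ (1 / n : ℝ) ≤ 1 / (2 * (|c| + 1)) :=
    ((ENNReal.ofReal_lt_ofReal_iff hε).1 hn).le
  have h3 : ‖a ^ n‖ ≤ (1 / (2 * (|c| + 1))) ^ n := by
    calc ‖a ^ n‖ = (‖a ^ n‖ ^ (1 / n : ℝ)) ^ n := by
          rw [one_div, Real.rpow_inv_natCast_pow (norm_nonneg _) hn0.ne']
      _ ≤ _ := by gcongr
  rw [norm_mul, norm_norm, norm_pow, Real.norm_eq_abs]
  calc |c| ^ n * ‖a ^ n‖ ≤ |c| ^ n * (1 / (2 * (|c| + 1))) ^ n := by gcongr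
    _ = (|c| * (1 / (2 * (|c| + 1)))) ^ n := (mul_pow _ _ _).symm
    _ ≤ (1 / 2) ^ n := by
      gcongr
      rw [mul_one_div, div_le_div_iff₀ (by positivity) two_pos]
      linarith

theorem tendsto_pow_mul_norm_apply_of_spectrum_subset [CompleteSpace X] {T : X →L[ℂ] X}
    (hT : spectrum ℂ T ⊆ {0}) (x : X) (c : ℝ) :
    Tendsto (fun n : ℕ => c ^ n * ‖(T ^ n) x‖) atTop (𝓝 0) := by
  have h1 := (tendsto_pow_mul_norm_pow_of_spectrum_subset hT c).abs.mul_const ‖x‖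
  rw [abs_zero, zero_mul] at h1
  refine squeeze_zero_norm (fun n => ?_) h1
  rw [norm_mul, norm_norm, abs_mul, abs_norm, Real.norm_eq_abs, mul_assoc]
  gcongr
  exact (T ^ n).le_opNorm x

/-- A point of the resolvent set of a bounded operator, regarded as an operator with domain `X`, is
not in its spectrum as an element of the Banach algebra of bounded operators. -/
theorem notMem_spectrum_of_mem_resolventSet {T : X →L[ℂ] X} {A : X →ₗ.[ℂ] X}
    (h : A = ofBounded T) {z : ℂ} (hz : z ∈ resolventSet A) : z ∉ spectrum ℂ T := by
  subst h
  obtain ⟨R, h1, h2⟩ := hz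
  -- The algebra spectrum uses `z - T`, while `resolventSet` uses `T - z`.
  rw [spectrum.notMem_iff, ← IsUnit.neg_iff]
  have hU : ∀ x, (-(algebraMap ℂ (X →L[ℂ] X) z - T)) x = T x - z • x := by
    intro x
    change -(z • x - T x) = _
    abel
  refine isUnit_iff_exists.2 ⟨R, ?_, ?_⟩
  · ext y
    obtain ⟨x, hx, hxy⟩ := h1 y
    rw [mul_apply_eq_comp, hU, ← hx]
    exact hxy
  · ext x
    rw [mul_apply_eq_comp, hU]
    exact h2 ⟨x, trivial⟩

theorem spectrum_sub_smul_one_subset {T : X →L[ℂ] X} {lam : ℂ}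
    (h : ∀ z ≠ lam, z ∈ resolventSet (ofBounded T)) : spectrum ℂ (T - lam • 1) ⊆ {0} := by
  intro w hw
  by_contra hw0
  refine notMem_spectrum_of_mem_resolventSet rfl (h (w + lam) (by simpa using hw0)) ?_
  rw [spectrum.mem_iff] at hw ⊢
  have h2 : algebraMap ℂ (X →L[ℂ] X) (w + lam) - T = algebraMap ℂ _ w - (T - lam • 1) := by
    rw [map_add, Algebra.algebraMap_eq_smul_one lam]
    abel
  rwa [h2]

/-! ### Nilpotence on the range of `P {lam}` -/

theorem part_eq_ofBounded_iff {A : X →ₗ.[ℂ] X} {M : Submodule ℂ X} {T : M →L[ℂ] M} :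
    part A M = ofBounded T ↔ ∀ x : M, ∃ h : (x : X) ∈ A.domain, A ⟨x, h⟩ = T x := by
  refine ⟨fun h x => ?_, fun h => LinearPMap.ext ?_ ?_⟩
  · have hx : x ∈ (part A M).domain := by rw [h]; trivial
    exact ⟨hx.1, congrArg Subtype.val (@(LinearPMap.ext_iff.1 h).2 x hx trivial)⟩
  · ext x
    refine ⟨fun _ => trivial, fun _ => ?_⟩
    obtain ⟨h1, h2⟩ := h x
    exact ⟨h1, h2 ▸ (T x).2⟩
  · intro x hx hx'
    obtain ⟨h1, h2⟩ := h x
    exact Subtype.ext h2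

/-- Since `lam ∈ σ`, `P {lam} X` is an invariant subspace of `P σ X`. The restriction of `S + N -
lam` to it is quasinilpotent, which forces `S = lam` and leaves only `N`. -/
theorem IsSpectralMeasureFor.exists_isNilpotent [CompleteSpace X] {P : Set ℂ → X →L[ℂ] X}
    {A : X →ₗ.[ℂ] X} (hP : IsSpectralMeasureFor P A) {lam : ℂ} {σ : Set ℂ} (hσ : σ ∈ 𝓝 lam)
    (hσm : MeasurableSet σ) (hfin : IsFiniteType (part A (ran (P σ)))) :
    ∃ N : Module.End ℂ (ran (P {lam})), IsNilpotent N ∧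
      part A (ran (P {lam})) - lam • (LinearMap.id : Module.End ℂ (ran (P {lam}))).toPMap ⊤ =
        N.toPMap ⊤ := by
  have hm := hP.isSpectralMeasure
  have hl := measurableSet_singleton lam
  obtain ⟨S, N, hS, hN, hSN, hA⟩ := hfin
  have hYc : CompleteSpace (ran (P σ)) :=
    (isClosed_ran (hm.isIdempotentElem σ hσm)).completeSpace_coe
  have hZc : CompleteSpace (ran (P {lam})) :=
    (isClosed_ran (hm.isIdempotentElem _ hl)).completeSpace_coe
  have hZY : ∀ z : ran (P {lam}), (z : X) ∈ ran (P σ) := by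
    rintro ⟨_, x, rfl⟩
    refine ⟨P {lam} x, ?_⟩
    change P σ (P {lam} x) = _
    rw [hm.apply_inter hσm hl, Set.inter_eq_right.2 (by simpa using mem_of_mem_nhds hσ)]
    rfl
  have hAT := part_eq_ofBounded_iff.1 hA
  have hTZ : ∀ z : ran (P {lam}),
      (((S + N) ⟨z, hZY z⟩ : ran (P σ)) : X) ∈ ran (P {lam}) := by
    intro z
    obtain ⟨h1, h2⟩ := hAT ⟨z, hZY z⟩
    rw [← h2]
    have h3 := (hP.commutesWith _ hl).apply h1
    refine ⟨A ⟨z, h1⟩, h3.symm.trans ?_⟩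
    congr 1
    exact Subtype.ext (apply_eq_self_of_mem_ran (hm.isIdempotentElem _ hl) z.2)
  let J : ran (P {lam}) →L[ℂ] ran (P σ) := (ran (P {lam})).subtypeL.codRestrict _ hZY
  let B : ran (P {lam}) →L[ℂ] ran (P {lam}) :=
    ((ran (P σ)).subtypeL ∘L (S + N) ∘L J).codRestrict _ hTZ
  have hB : part A (ran (P {lam})) = ofBounded B :=
    part_eq_ofBounded_iff.2 fun z => hAT ⟨z, hZY z⟩
  let D : ran (P {lam}) →L[ℂ] ran (P {lam}) := B - lam • 1
  let D' : ran (P σ) →L[ℂ] ran (P σ) := S + N - lam • 1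
  have hJD : ∀ z, J (D z) = D' (J z) := fun z => rfl
  have hJDn : ∀ (n : ℕ) z, J ((D ^ n) z) = (D' ^ n) (J z) := by
    intro n
    induction n with
    | zero => exact fun z => rfl
    | succ n ih =>
      intro z
      rw [pow_succ', pow_succ', mul_apply_eq_comp, mul_apply_eq_comp, hJD, ih]
  have hspec : spectrum ℂ D ⊆ {0} := spectrum_sub_smul_one_subset fun z hz =>
    hB ▸ hP.mem_resolventSet hl (by simpa using hz)
  -- `J` intertwines `D` and `D'` and is isometric, both norms being inherited from `X`.
  have hq : ∀ z (c : ℝ), Tendsto (fun n : ℕ => c ^ n * ‖(D' ^ n) (J z)‖) atTop (𝓝 0) := by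
    intro z c
    have h1 := tendsto_pow_mul_norm_apply_of_spectrum_subset hspec z c
    refine h1.congr fun n => ?_
    rw [← hJDn]
    rfl
  have hDN : ∀ z, J (D z) = N (J z) := by
    intro z
    have h1 := apply_eq_smul_of_quasinilpotent hS hN hSN (hq z)
    change S (J z) + N (J z) - lam • J z = _
    rw [h1]
    abel
  have hDNn : ∀ (n : ℕ) z, J ((D ^ n) z) = (N ^ n) (J z) := by
    intro n
    induction n with
    | zero => exact fun z => rfl
    | succ n ih =>
      intro z
      rw [pow_succ', pow_succ', mul_apply_eq_comp, mul_apply_eq_comp, hDN, ih]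
  obtain ⟨k, hk⟩ := hN
  refine ⟨(D : ran (P {lam}) →ₗ[ℂ] ran (P {lam})), ⟨k, ?_⟩, ?_⟩
  · ext z
    have h1 := hDNn k z
    rw [hk] at h1
    rw [← ContinuousLinearMap.toLinearMap_pow]
    have h2 := congrArg Subtype.val h1
    exact h2
  · refine part_sub_smul_eq_iff.2 fun z => ?_
    obtain ⟨h1, h2⟩ := hAT ⟨z, hZY z⟩
    refine ⟨h1, ?_⟩
    rw [h2]
    rfl

theorem IsSpectralMeasureFor.isWeaklyAssociated [CompleteSpace X] {P : Set ℂ → X →L[ℂ] X}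
    {A : X →ₗ.[ℂ] X} (hP : IsSpectralMeasureFor P A) {lam : ℂ} {σ : Set ℂ} (hσ : σ ∈ 𝓝 lam)
    (hσm : MeasurableSet σ) (hfin : IsFiniteType (part A (ran (P σ)))) :
    IsWeaklyAssociated (P {lam}) A lam := by
  have hl := measurableSet_singleton lam
  have hc := hP.isSpectralMeasure.compl hl
  refine ⟨hP.isSpectralMeasure.isIdempotentElem _ hl, hP.commutesWith _ hl,
    hP.map_domain _ hl Bornology.isBounded_singleton, hP.exists_isNilpotent hσ hσm hfin, ?_, ?_⟩
  · rw [← hc]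
    exact hP.injective_compl_singleton lam
  · rw [← hc]
    exact hP.denseRange_compl_singleton lam

end SpectralOp

theorem mainTheorem11 {X : Type*} [NormedAddCommGroup X] [NormedSpace ℂ X] [CompleteSpace X]
    (A : X →ₗ.[ℂ] X) (hA : SpectralOp.IsSpectralOperator A)
    (P : Set ℂ → X →L[ℂ] X) (hP : SpectralOp.IsSpectralMeasureFor P A)
    (lam : ℂ) (hlam : lam ∈ SpectralOp.spectrumSet A)
    (hfin : ∃ σ ∈ 𝓝 lam, MeasurableSet σ ∧ Bornology.IsBounded σ ∧
      SpectralOp.IsFiniteType (SpectralOp.part A (SpectralOp.ran (P σ)))) :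
    SpectralOp.IsWeaklyAssociated (P {lam}) A lam ∧
      ∀ Q : X →L[ℂ] X, SpectralOp.IsWeaklyAssociated Q A lam → Q = P {lam} := by
  obtain ⟨σ, hσ, hσm, -, hft⟩ := hfin
  have h := hP.isWeaklyAssociated hσ hσm hft
  exact ⟨h, fun Q hQ => hP.eq_of_isWeaklyAssociated h hQ⟩
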